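/- Let $M$ be a Riemannian globally symmetric space of compact type, let $G$ be the identity component of its isometry group (a compact semisimple Lie group), let $p\in M$, and let $K$ be the isotropy group of $p$ in $G$, so that $M\simeq G/K$. Let $T$ be a maximal flat totally geodesic torus of $M$ containing $p$, and let $L=\{g\in G : gT=T\}$. The group $G$ acts transitively on the set $M'$ of all maximal flat totally geodesic tori in $M$, and $M'$ is identified with $G/L$ through $gT\leftrightarrow gL$; likewise $T\simeq L/(L\cap K)$. Equip $M\simeq G/K$, $M'\simeq G/L$ and $T\simeq L/(L\cap K)$ with their normalized invariant (Haar) measures, the last one denoted $\mu_T$. For $X=M$ or $X=M'$, a representative function on $X$ is a continuous function $f:X\to\mathbb{C}$ whose translates $x\mapsto f(g^{-1}x)$, $g\in G$, span a finite-dimensional space; let $\mathcal{R}(X)$ be the space of these functions. Define the linear map $\tau_0:\mathcal{R}(M)\to\mathcal{R}(M')$ by $$(\tau_0(f))(gT)=\int_{x\in T} f(gx)\,d\mu_T(x).$$ Then for every $f\in\mathcal{R}(M)$ we have $\|\tau_0(f)\|_{L^2(M')}\le\|f\|_{L^2(M)}$. Moreover, there is exactly one bounded linear operator $\tau:L^2(M)\to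 L^2(M')$ with $\tau(f)=\tau_0(f)$ for all $f\in\mathcal{R}(M)$. -/

import Mathlib

open Set Filter Topology MeasureTheory Manifold Bundle
open scoped ContDiff Pointwise

noncomputable section

namespace FlatRadon

/-! ### The isometry group of a metric space and its identity component -/

section IsometryGroup

variable {M : Type*} [MetricSpace M]

/-- An isometry as a continuous map. -/
def isometryToContinuousMap (e : M ≃ᵢ M) : C(M, M) := ⟨e, e.continuous⟩

/-- The isometry group carries the compact-open topology. -/
instance : TopologicalSpace (M ≃ᵢ M) :=
  TopologicalSpace.induced isometryToContinuousMap inferInstance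

instance : MeasurableSpace (M ≃ᵢ M) := borel _

instance : BorelSpace (M ≃ᵢ M) := ⟨rfl⟩

/-- The isometry group acts on the space by evaluation. -/
instance : MulAction (M ≃ᵢ M) M where
  smul e x := e x
  one_smul _ := rfl
  mul_smul _ _ _ := rfl

theorem isInducing_isometryToContinuousMap :
    IsInducing (isometryToContinuousMap : (M ≃ᵢ M) → C(M, M)) := ⟨rfl⟩

instance [CompactSpace M] : FirstCountableTopology (M ≃ᵢ M) :=
  isInducing_isometryToContinuousMap.firstCountableTopology

instance [CompactSpace M] : IsTopologicalGroup (M ≃ᵢ M) where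
  continuous_mul := by
    rw [isInducing_isometryToContinuousMap.continuous_iff]
    have h := isInducing_isometryToContinuousMap (M := M).continuous
    exact (h.comp continuous_fst).compCM (h.comp continuous_snd)
  continuous_inv := by
    rw [isInducing_isometryToContinuousMap.continuous_iff, continuous_iff_continuousAt]
    intro e
    have h := isInducing_isometryToContinuousMap (M := M).continuous.continuousAt (x := e)
    rw [ContinuousAt, Metric.tendsto_nhds] at h ⊢
    intro ε hε
    filter_upwards [h ε hε] with e' he'
    rw [ContinuousMap.dist_lt_iff hε] at he' ⊢
    intro x
    have h1 := he' (e⁻¹ x)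
    have h2 : dist (e'⁻¹ x) (e⁻¹ x) = dist (e' (e'⁻¹ x)) (e' (e⁻¹ x)) := (e'.dist_eq _ _).symm
    change dist (e' (e⁻¹ x)) (e (e⁻¹ x)) < ε at h1
    change dist (e'⁻¹ x) (e⁻¹ x) < ε
    rw [h2, IsometryEquiv.apply_inv_self, dist_comm]
    rwa [IsometryEquiv.apply_inv_self] at h1

instance [CompactSpace M] : ContinuousSMul (M ≃ᵢ M) M where
  continuous_smul := by
    have h := isInducing_isometryToContinuousMap (M := M).continuous
    exact (continuous_eval (F := C(M, M))).comp
      ((h.comp continuous_fst).prodMk continuous_snd)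

/-- The isometry group of a compact metric space is compact (Arzelà–Ascoli). -/
instance [CompactSpace M] : CompactSpace (M ≃ᵢ M) := by
  constructor
  rw [isInducing_isometryToContinuousMap.isCompact_iff, image_univ]
  have hS : IsCompact {f : C(M, M) | Isometry f} := by
    refine ArzelaAscoli.isCompact_of_equicontinuous _ ?_ ?_
    · have h : ContinuousMap.toFun '' {f : C(M, M) | Isometry f} = {f : M → M | Isometry f} := by
        ext f
        constructor
        · rintro ⟨g, hg, rfl⟩
          exact hg
        · intro hf
          exact ⟨⟨f, hf.continuous⟩, hf, rfl⟩
      rw [h]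
      apply IsClosed.isCompact
      simp only [isometry_iff_dist_eq, ofPred_forall]
      refine isClosed_iInter fun x => isClosed_iInter fun y => ?_
      exact isClosed_eq ((continuous_apply x).dist (continuous_apply y)) continuous_const
    · refine (Metric.equicontinuous_of_continuity_modulus (fun t => t) tendsto_id _ ?_)
      intro x y f
      exact (f.2.dist_eq x y).le
  have hP : IsCompact (({f : C(M, M) | Isometry f} ×ˢ {f : C(M, M) | Isometry f}) ∩
      {q : C(M, M) × C(M, M) | q.1.comp q.2 = ContinuousMap.id M ∧
        q.2.comp q.1 = ContinuousMap.id M}) := by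
    refine (hS.prod hS).inter_right (IsClosed.inter ?_ ?_)
    · exact isClosed_eq (continuous_fst.compCM continuous_snd) continuous_const
    · exact isClosed_eq (continuous_snd.compCM continuous_fst) continuous_const
  convert hP.image continuous_fst
  ext f
  constructor
  · rintro ⟨e, rfl⟩
    refine ⟨(isometryToContinuousMap e, isometryToContinuousMap e⁻¹),
      ⟨⟨e.isometry, (e⁻¹).isometry⟩, ?_, ?_⟩, rfl⟩
    · ext x
      exact e.apply_inv_self x
    · ext x
      exact e.inv_apply_self x
  · rintro ⟨⟨f, g⟩, ⟨⟨hf, -⟩, h1, h2⟩, rfl⟩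
    refine ⟨⟨⟨f, g, fun x => ?_, fun x => ?_⟩, hf⟩, rfl⟩
    · exact DFunLike.congr_fun h2 x
    · exact DFunLike.congr_fun h1 x

variable (M) in
/-- The group `G`: the identity component of the isometry group. -/
abbrev IsomGroup [CompactSpace M] : Subgroup (M ≃ᵢ M) :=
  Subgroup.connectedComponentOfOne (M ≃ᵢ M)

instance [CompactSpace M] : FirstCountableTopology (IsomGroup M) :=
  IsInducing.subtypeVal.firstCountableTopology

instance [CompactSpace M] : CompactSpace (IsomGroup M) :=
  isCompact_iff_compactSpace.mp (isClosed_connectedComponent (x := (1 : M ≃ᵢ M))).isCompact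

end IsometryGroup

/-! ### Symmetric spaces of compact type -/

/-- A connected Lie group is semisimple if it has no non-trivial connected solvable normal
subgroup. -/
def IsSemisimpleGroup (G : Type*) [Group G] [TopologicalSpace G] : Prop :=
  ∀ N : Subgroup G, N.Normal → IsConnected (N : Set G) → Group.IsSolvable N → N = ⊥

/-- A compact connected Riemannian manifold `M` is a globally symmetric space of compact type if
every point is an isolated fixed point of an involutive isometry, and the identity component of
the isometry group (a compact Lie group) is semisimple.  Isometries of a Riemannian manifold are
the bijections that preserve the Riemannian distance. -/
structure IsCompactTypeSymmetricSpace (M : Type*) [MetricSpace M] [CompactSpace M] : Prop where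
  exists_symmetry : ∀ p : M, ∃ s : M ≃ᵢ M, s * s = 1 ∧ s p = p ∧ ∀ᶠ x in 𝓝[≠] p, s x ≠ x
  semisimple : IsSemisimpleGroup (IsomGroup M)

/-! ### Flat totally geodesic tori -/

/-- A geodesic defined on the whole line: locally, a distance-realizing curve of constant
speed. -/
def IsGeodesicLine {M : Type*} [MetricSpace M] (γ : ℝ → M) : Prop :=
  ∃ c : ℝ, 0 ≤ c ∧ ∀ t₀ : ℝ, ∃ ε > 0, ∀ s ∈ Ioo (t₀ - ε) (t₀ + ε), ∀ t ∈ Ioo (t₀ - ε) (t₀ + ε),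
    dist (γ s) (γ t) = c * |s - t|

section Torus

variable (n : ℕ) {M : Type*} [MetricSpace M] [ChartedSpace (EuclideanSpace ℝ (Fin n)) M]
  [RiemannianBundle (fun x : M => TangentSpace (𝓡 n) x)]

/-- `T` is a flat totally geodesic torus: it is the image of a smooth map `Φ : ℝʳ → M` that
is isometric on tangent spaces, sends straight lines to geodesics of `M`, and induces an injective
map on the quotient of `ℝʳ` by the lattice spanned by a basis `b`. -/
def IsFlatTorus (T : Set M) : Prop :=
  ∃ (r : ℕ) (b : Module.Basis (Fin r) ℝ (EuclideanSpace ℝ (Fin r)))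
    (Φ : EuclideanSpace ℝ (Fin r) → M),
    ContMDiff (𝓡 r) (𝓡 n) ∞ Φ ∧
    (∀ (x : EuclideanSpace ℝ (Fin r)) (v : TangentSpace (𝓡 r) x),
      ‖mfderiv (𝓡 r) (𝓡 n) Φ x v‖ = ‖v‖) ∧
    (∀ x v : EuclideanSpace ℝ (Fin r), IsGeodesicLine fun t : ℝ => Φ (x + t • v)) ∧
    (∀ x y : EuclideanSpace ℝ (Fin r), Φ x = Φ y ↔ x - y ∈ Submodule.span ℤ (range b)) ∧
    range Φ = T

theorem IsFlatTorus.isCompact {T : Set M} (hT : IsFlatTorus n T) : IsCompact T := by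
  obtain ⟨r, b, Φ, hΦ, -, -, hper, rfl⟩ := hT
  have h : range Φ = Φ '' closure (ZSpan.fundamentalDomain b) := by
    refine (range_subset_iff.2 fun x => ?_).antisymm (image_subset_range _ _)
    refine ⟨ZSpan.fract b x, subset_closure (ZSpan.fract_mem_fundamentalDomain b x), ?_⟩
    rw [hper, ZSpan.fract_apply, sub_sub_cancel_left]
    exact neg_mem (ZSpan.floor b x).2
  rw [h]
  exact (ZSpan.fundamentalDomain_isBounded b).isCompact_closure.image hΦ.continuous

/-- A maximal flat totally geodesic torus `T` containing `p`. -/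
structure MaximalTorus (p : M) where
  carrier : Set M
  maximal : Maximal (IsFlatTorus n) carrier
  mem : p ∈ carrier

variable {n} [CompactSpace M] {p : M} (T : MaximalTorus n p)

/-- The subgroup `L` of `G`: the stabilizer `{g | g T = T}` of the torus `T`. -/
def torusStabilizer : Subgroup (IsomGroup M) :=
  MulAction.stabilizer (IsomGroup M) T.carrier

theorem isClosed_torusStabilizer : IsClosed (torusStabilizer T : Set (IsomGroup M)) := by
  have hT : IsClosed T.carrier := (IsFlatTorus.isCompact n T.maximal.prop).isClosed
  have h : (torusStabilizer T : Set (IsomGroup M)) =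
      (⋂ x ∈ T.carrier, {g : IsomGroup M | g • x ∈ T.carrier}) ∩
      (⋂ x ∈ T.carrier, {g : IsomGroup M | g⁻¹ • x ∈ T.carrier}) := by
    ext g
    simp only [torusStabilizer, SetLike.mem_coe, MulAction.mem_stabilizer_iff, mem_inter_iff,
      mem_iInter, mem_ofPred_eq]
    constructor
    · intro hg
      refine ⟨fun x hx => hg ▸ smul_mem_smul_set hx, fun x hx => ?_⟩
      rw [← mem_smul_set_iff_inv_smul_mem, hg]
      exact hx
    · rintro ⟨h1, h2⟩
      refine Subset.antisymm ?_ fun x hx => mem_smul_set_iff_inv_smul_mem.2 (h2 x hx)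
      rintro _ ⟨x, hx, rfl⟩
      exact h1 x hx
  rw [h]
  refine IsClosed.inter ?_ ?_
  · exact isClosed_biInter fun x _ => hT.preimage (continuous_id.smul continuous_const)
  · exact isClosed_biInter fun x _ => hT.preimage (continuous_inv.smul continuous_const)

instance : CompactSpace (torusStabilizer T) :=
  isCompact_iff_compactSpace.mp (isClosed_torusStabilizer T).isCompact

/-- The space `M'` of maximal flat totally geodesic tori, as the homogeneous space `G ⧸ L`:
the coset `g L` stands for the torus `g T`. -/
def TorusSpace : Type _ := IsomGroup M ⧸ torusStabilizer T

instance : TopologicalSpace (TorusSpace T) :=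
  inferInstanceAs (TopologicalSpace (IsomGroup M ⧸ torusStabilizer T))

instance : CompactSpace (TorusSpace T) :=
  inferInstanceAs (CompactSpace (IsomGroup M ⧸ torusStabilizer T))

instance : MulAction (IsomGroup M) (TorusSpace T) :=
  inferInstanceAs (MulAction (IsomGroup M) (IsomGroup M ⧸ torusStabilizer T))

instance : ContinuousConstSMul (IsomGroup M) (TorusSpace T) :=
  inferInstanceAs (ContinuousConstSMul (IsomGroup M) (IsomGroup M ⧸ torusStabilizer T))

instance : MeasurableSpace (TorusSpace T) := borel _

instance : BorelSpace (TorusSpace T) := ⟨rfl⟩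

/-- The point `g T` of `M'`. -/
def TorusSpace.mk (g : IsomGroup M) : TorusSpace T :=
  (QuotientGroup.mk g : IsomGroup M ⧸ torusStabilizer T)

theorem TorusSpace.continuous_mk : Continuous (TorusSpace.mk T) :=
  QuotientGroup.continuous_mk

theorem TorusSpace.smul_mk (g h : IsomGroup M) :
    g • TorusSpace.mk T h = TorusSpace.mk T (g * h) := rfl

end Torus

/-! ### Normalized invariant measures -/

/-- The normalized Haar measure of a compact group. -/
def normalizedHaar (G : Type*) [Group G] [TopologicalSpace G] [IsTopologicalGroup G]
    [CompactSpace G] [MeasurableSpace G] [BorelSpace G] : Measure G :=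
  Measure.haarMeasure ⊤

instance (G : Type*) [Group G] [TopologicalSpace G] [IsTopologicalGroup G]
    [CompactSpace G] [MeasurableSpace G] [BorelSpace G] :
    IsProbabilityMeasure (normalizedHaar G) :=
  ⟨by
    have h := Measure.haarMeasure_self (G := G) (K₀ := ⊤)
    rwa [TopologicalSpace.PositiveCompacts.coe_top] at h⟩

instance (G : Type*) [Group G] [TopologicalSpace G] [IsTopologicalGroup G]
    [CompactSpace G] [MeasurableSpace G] [BorelSpace G] :
    (normalizedHaar G).IsMulLeftInvariant :=
  inferInstanceAs (Measure.haarMeasure (⊤ : TopologicalSpace.PositiveCompacts G)).IsMulLeftInvariant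

section Measures

variable {M : Type*} [MetricSpace M] [CompactSpace M]

/-- The normalized invariant measure of `M ≃ G ⧸ K`: the image of the Haar measure of `G` under
the orbit map `g ↦ g p`. -/
def spaceMeasure [MeasurableSpace M] (p : M) : Measure M :=
  (normalizedHaar (IsomGroup M)).map fun g => g • p

instance [MeasurableSpace M] [BorelSpace M] (p : M) : IsProbabilityMeasure (spaceMeasure p) :=
  Measure.isProbabilityMeasure_map
    (continuous_id.smul continuous_const : Continuous fun g : IsomGroup M => g • p).aemeasurable

variable {n : ℕ} [ChartedSpace (EuclideanSpace ℝ (Fin n)) M]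
  [RiemannianBundle (fun x : M => TangentSpace (𝓡 n) x)] {p : M} (T : MaximalTorus n p)

/-- The normalized invariant measure of `M' = G ⧸ L`: the image of the Haar measure of `G`. -/
def torusSpaceMeasure : Measure (TorusSpace T) :=
  (normalizedHaar (IsomGroup M)).map (TorusSpace.mk T)

instance : IsProbabilityMeasure (torusSpaceMeasure T) :=
  Measure.isProbabilityMeasure_map (TorusSpace.continuous_mk T).aemeasurable

/-- The normalized invariant measure `μ_T` of `T ≃ L ⧸ (L ∩ K)`, as a measure on `M`: the image of
the Haar measure of `L` under the orbit map `l ↦ l p`. -/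
def torusMeasure [MeasurableSpace M] : Measure M :=
  (normalizedHaar (torusStabilizer T)).map fun l : torusStabilizer T => (l : IsomGroup M) • p

theorem measurable_torusOrbit [MeasurableSpace M] [BorelSpace M] :
    Measurable fun l : torusStabilizer T => (l : IsomGroup M) • p :=
  (continuous_subtype_val.smul continuous_const).measurable

instance [MeasurableSpace M] [BorelSpace M] : IsProbabilityMeasure (torusMeasure T) :=
  Measure.isProbabilityMeasure_map (measurable_torusOrbit T).aemeasurable

end Measures

/-! ### Representative functions -/

section Representative

variable {G X : Type*} [Group G] [TopologicalSpace X] [MulAction G X] [ContinuousConstSMul G X]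

/-- The action `(g f)(x) = f (g⁻¹ x)` of `G` on continuous functions. -/
def translate (g : G) : C(X, ℂ) →ₗ[ℂ] C(X, ℂ) where
  toFun f := ⟨fun x => f (g⁻¹ • x), f.continuous.comp (continuous_const_smul _)⟩
  map_add' _ _ := rfl
  map_smul' _ _ := rfl

variable (G) in
/-- The span of the translates of `f`. -/
def translateSpan (f : C(X, ℂ)) : Submodule ℂ C(X, ℂ) :=
  Submodule.span ℂ (range fun g : G => translate g f)

theorem translate_mem_translateSpan (f : C(X, ℂ)) (g : G) :
    translate g f ∈ translateSpan G f :=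
  Submodule.subset_span ⟨g, rfl⟩

variable (G X) in
/-- The representative functions on `X`: the continuous functions that are `G`-finite, that is,
whose translates span a finite-dimensional space. -/
def representativeFunctions : Submodule ℂ C(X, ℂ) where
  carrier := {f | FiniteDimensional ℂ (translateSpan G f)}
  zero_mem' := by
    have h : translateSpan G (0 : C(X, ℂ)) = ⊥ := by
      simp [translateSpan]
    change FiniteDimensional ℂ (translateSpan G (0 : C(X, ℂ)))
    rw [h]
    infer_instance
  add_mem' {f₁ f₂} h₁ h₂ := by
    change FiniteDimensional ℂ (translateSpan G f₁) at h₁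
    change FiniteDimensional ℂ (translateSpan G f₂) at h₂
    have h : translateSpan G (f₁ + f₂) ≤ translateSpan G f₁ ⊔ translateSpan G f₂ := by
      refine Submodule.span_le.2 ?_
      rintro _ ⟨g, rfl⟩
      change translate g (f₁ + f₂) ∈ _
      rw [map_add]
      exact Submodule.add_mem_sup (translate_mem_translateSpan f₁ g)
        (translate_mem_translateSpan f₂ g)
    exact Submodule.finiteDimensional_of_le h
  smul_mem' c f hf := by
    change FiniteDimensional ℂ (translateSpan G f) at hf
    have h : translateSpan G (c • f) ≤ translateSpan G f := by
      refine Submodule.span_le.2 ?_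
      rintro _ ⟨g, rfl⟩
      change translate g (c • f) ∈ _
      rw [map_smul]
      exact Submodule.smul_mem _ _ (translate_mem_translateSpan f g)
    exact Submodule.finiteDimensional_of_le h

end Representative

/-! ### The torus transform on representative functions -/

section Transform

variable {M : Type*} [MetricSpace M] [CompactSpace M] [MeasurableSpace M] [BorelSpace M]
  {n : ℕ} [ChartedSpace (EuclideanSpace ℝ (Fin n)) M]
  [RiemannianBundle (fun x : M => TangentSpace (𝓡 n) x)] {p : M} (T : MaximalTorus n p)

theorem integral_torusMeasure_smul (f : C(M, ℂ)) (g : IsomGroup M) (l : torusStabilizer T) :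
    ∫ x, f ((g * l) • x) ∂torusMeasure T = ∫ x, f (g • x) ∂torusMeasure T := by
  have hc : ∀ g : IsomGroup M, Continuous fun x : M => f (g • x) := fun g =>
    f.continuous.comp (continuous_const_smul g)
  rw [torusMeasure, integral_map (measurable_torusOrbit T).aemeasurable
      (hc _).aestronglyMeasurable, integral_map (measurable_torusOrbit T).aemeasurable
      (hc _).aestronglyMeasurable]
  rw [← integral_mul_left_eq_self (fun m : torusStabilizer T => f (g • (m : IsomGroup M) • p)) l]
  simp only [mul_smul, Subgroup.coe_mul]

/-- The integral `∫_{x ∈ T} f (g x) dμ_T`, as a function of the torus `g T`. -/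
def torusIntegral (f : C(M, ℂ)) : TorusSpace T → ℂ :=
  Quotient.lift (fun g : IsomGroup M => ∫ x, f (g • x) ∂torusMeasure T) (by
    intro g h hgh
    have hl : g⁻¹ * h ∈ torusStabilizer T := QuotientGroup.leftRel_apply.1 hgh
    have := integral_torusMeasure_smul T f g ⟨g⁻¹ * h, hl⟩
    simpa using this.symm)

theorem torusIntegral_mk (f : C(M, ℂ)) (g : IsomGroup M) :
    torusIntegral T f (TorusSpace.mk T g) = ∫ x, f (g • x) ∂torusMeasure T := rfl

theorem continuous_torusIntegral (f : C(M, ℂ)) : Continuous (torusIntegral T f) := by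
  refine (QuotientGroup.isQuotientMap_mk (torusStabilizer T)).continuous_iff.2 ?_
  change Continuous fun g : IsomGroup M => ∫ x, f (g • x) ∂torusMeasure T
  have h : Continuous (fun q : IsomGroup M × M => f (q.1 • q.2)) :=
    f.continuous.comp continuous_smul
  have := continuous_parametric_integral_of_continuous (μ := torusMeasure T)
    (f := fun (g : IsomGroup M) (x : M) => f (g • x)) h isCompact_univ
  simpa using this

theorem integrable_torusMeasure (f : C(M, ℂ)) (g : IsomGroup M) :
    Integrable (fun x => f (g • x)) (torusMeasure T) :=
  (f.continuous.comp (continuous_const_smul g)).integrable_of_hasCompactSupport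
    (HasCompactSupport.of_compactSpace _)

/-- The torus transform on continuous functions. -/
def torusTransformC : C(M, ℂ) →ₗ[ℂ] C(TorusSpace T, ℂ) where
  toFun f := ⟨torusIntegral T f, continuous_torusIntegral T f⟩
  map_add' f₁ f₂ := by
    ext q
    obtain ⟨g, rfl⟩ := QuotientGroup.mk_surjective q
    exact integral_add (integrable_torusMeasure T f₁ g) (integrable_torusMeasure T f₂ g)
  map_smul' c f := by
    ext q
    obtain ⟨g, rfl⟩ := QuotientGroup.mk_surjective q
    exact integral_smul c (fun x : M => f (g • x))

theorem torusTransformC_translate (f : C(M, ℂ)) (g : IsomGroup M) :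
    torusTransformC T (translate g f) = translate g (torusTransformC T f) := by
  ext q
  obtain ⟨h, rfl⟩ := QuotientGroup.mk_surjective q
  change ∫ x, f (g⁻¹ • h • x) ∂torusMeasure T = ∫ x, f ((g⁻¹ * h) • x) ∂torusMeasure T
  simp only [mul_smul]

theorem torusTransformC_mem {f : C(M, ℂ)} (hf : f ∈ representativeFunctions (IsomGroup M) M) :
    torusTransformC T f ∈ representativeFunctions (IsomGroup M) (TorusSpace T) := by
  change FiniteDimensional ℂ (translateSpan (IsomGroup M) f) at hf
  have h : translateSpan (IsomGroup M) (torusTransformC T f) =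
      (translateSpan (IsomGroup M) f).map (torusTransformC T) := by
    rw [translateSpan, translateSpan, Submodule.map_span, ← range_comp]
    congr 2
    ext g : 1
    exact (torusTransformC_translate T f g).symm
  change FiniteDimensional ℂ (translateSpan (IsomGroup M) (torusTransformC T f))
  rw [h]
  infer_instance

/-- The torus transform `τ₀`, `(τ₀ f)(g T) = ∫_{x ∈ T} f (g x) dμ_T`, from the representative
functions on `M` to those on `M'`. -/
def tau0 : representativeFunctions (IsomGroup M) M →ₗ[ℂ]
    representativeFunctions (IsomGroup M) (TorusSpace T) :=
  (torusTransformC T).restrict fun _ hf => torusTransformC_mem T hf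

theorem tau0_apply (f : representativeFunctions (IsomGroup M) M) (g : IsomGroup M) :
    (tau0 T f : C(TorusSpace T, ℂ)) (TorusSpace.mk T g) =
      ∫ x, (f : C(M, ℂ)) (g • x) ∂torusMeasure T := rfl

end Transform

end FlatRadon

end

noncomputable section

namespace FlatRadon

open scoped InnerProductSpace ComplexConjugate

/-! ### Invariance of the normalized measures -/

/-! Norm inequality: on each torus, Jensen bounds the squared modulus of the mean of `f` by the mean
of `|f|²`. Averaging over `G`, Fubini gives an average over `l ∈ L` of `∫ |f (g l p)|² dg`. Since
compact groups are unimodular, this does not depend on `l` and equals the integral of `|f|²` over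
`M`. The argument works for every continuous `f` (`norm_toLp_torusTransformC_le`).

Existence and uniqueness of `τ` then reduce to density of the representative functions in `L²(M)`
(`denseRange_representativeFunctions`), proved as in the Peter–Weyl theorem. The kernel `max (ε -
dist x y) 0` is continuous, real, symmetric and invariant under isometries, so its integral operator
is compact, self-adjoint and commutes with `G`. Its eigenspaces for non-zero eigenvalues are
finite-dimensional, `G`-stable and made of continuous functions, hence of representative functions.
By the spectral theorem, a vector orthogonal to all representative functions is killed by the
operator for every `ε`. Up to a scalar factor, these operators approximate the identity on
continuous functions as `ε → 0`, so the vector is orthogonal to all continuous functions and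
vanishes. -/

instance (G : Type*) [Group G] [TopologicalSpace G] [IsTopologicalGroup G]
    [CompactSpace G] [MeasurableSpace G] [BorelSpace G] :
    (normalizedHaar G).IsHaarMeasure :=
  inferInstanceAs (Measure.haarMeasure (⊤ : TopologicalSpace.PositiveCompacts G)).IsHaarMeasure

instance (G : Type*) [Group G] [TopologicalSpace G] [IsTopologicalGroup G]
    [CompactSpace G] [MeasurableSpace G] [BorelSpace G] :
    (normalizedHaar G).Regular :=
  inferInstanceAs (Measure.haarMeasure (⊤ : TopologicalSpace.PositiveCompacts G)).Regular

/-- Compact groups are unimodular. -/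
instance (G : Type*) [Group G] [TopologicalSpace G] [IsTopologicalGroup G]
    [CompactSpace G] [MeasurableSpace G] [BorelSpace G] :
    (normalizedHaar G).IsMulRightInvariant where
  map_mul_right_eq_self g := by
    have : IsProbabilityMeasure ((normalizedHaar G).map (· * g)) :=
      Measure.isProbabilityMeasure_map (measurable_mul_const g).aemeasurable
    have : ((normalizedHaar G).map (· * g)).Regular :=
      Measure.Regular.map (Homeomorph.mulRight g)
    -- A right translate of Haar measure is still left invariant, so uniqueness of the normalized
    -- Haar measure applies.
    exact Measure.isHaarMeasure_eq_of_isProbabilityMeasure _ _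

/-! ### Integrals and `L²` norms of continuous functions -/

section ContinuousFunctions

variable {X : Type*} [TopologicalSpace X] [CompactSpace X] [MeasurableSpace X] [BorelSpace X]
  (μ : Measure X) [IsFiniteMeasure μ]

theorem integrable_of_continuous {E : Type*} [NormedAddCommGroup E]
    [SecondCountableTopologyEither X E] {f : X → E} (hf : Continuous f) : Integrable f μ :=
  hf.integrable_of_hasCompactSupport (HasCompactSupport.of_compactSpace _)

theorem norm_toLp_sq (f : C(X, ℂ)) :
    ‖ContinuousMap.toLp (E := ℂ) 2 μ ℂ f‖ ^ 2 = ∫ x, ‖f x‖ ^ 2 ∂μ := by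
  have h := ContinuousMap.inner_toLp (𝕜 := ℂ) μ f f
  rw [inner_self_eq_norm_sq_to_K] at h
  simp_rw [Complex.mul_conj, Complex.normSq_eq_norm_sq] at h
  rw [integral_complex_ofReal] at h
  exact Complex.ofReal_injective (by simpa using h)

end ContinuousFunctions

/-- Jensen's inequality for `t ↦ t²`, applied to the norm of `f`. -/
theorem norm_integral_sq_le {X E : Type*} [MeasurableSpace X] (μ : Measure X)
    [IsProbabilityMeasure μ] [NormedAddCommGroup E] [NormedSpace ℝ E] {f : X → E}
    (hf : Integrable f μ) (hf2 : Integrable (fun x => ‖f x‖ ^ 2) μ) :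
    ‖∫ x, f x ∂μ‖ ^ 2 ≤ ∫ x, ‖f x‖ ^ 2 ∂μ := by
  have h1 : ‖∫ x, f x ∂μ‖ ^ 2 ≤ (∫ x, ‖f x‖ ∂μ) ^ 2 := by
    gcongr
    exact norm_integral_le_integral_norm f
  refine h1.trans ?_
  exact (even_two.convexOn_pow (𝕜 := ℝ)).map_integral_le (continuous_pow 2).continuousOn
    isClosed_univ (by simp) hf.norm hf2

/-! ### The norm inequality -/

section NormInequality

/-- Moving the base point along its orbit is a right translation in the group; this is where
unimodularity enters. -/
theorem integral_smul_smul_base {E : Type*} [NormedAddCommGroup E] [NormedSpace ℝ E]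
    {M : Type*} [MetricSpace M] [CompactSpace M] (p : M) {f : M → E} (h : IsomGroup M) :
    ∫ g : IsomGroup M, f (g • h • p) ∂normalizedHaar (IsomGroup M) =
      ∫ g : IsomGroup M, f (g • p) ∂normalizedHaar (IsomGroup M) := by
  simp_rw [← mul_smul]
  exact integral_mul_right_eq_self (fun g : IsomGroup M => f (g • p)) h

theorem integral_torusSpaceMeasure {E : Type*} [NormedAddCommGroup E] [NormedSpace ℝ E]
    [SecondCountableTopology E] {M : Type*} [MetricSpace M] [CompactSpace M]
    {n : ℕ} [ChartedSpace (EuclideanSpace ℝ (Fin n)) M]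
    [RiemannianBundle (fun x : M => TangentSpace (𝓡 n) x)] {p : M} (T : MaximalTorus n p)
    {f : TorusSpace T → E} (hf : Continuous f) :
    ∫ q, f q ∂torusSpaceMeasure T =
      ∫ g : IsomGroup M, f (TorusSpace.mk T g) ∂normalizedHaar (IsomGroup M) := by
  borelize E
  exact integral_map (TorusSpace.continuous_mk T).aemeasurable
    hf.measurable.aestronglyMeasurable

variable {M : Type*} [MetricSpace M] [CompactSpace M] [MeasurableSpace M] [BorelSpace M]

theorem integral_spaceMeasure {E : Type*} [NormedAddCommGroup E] [NormedSpace ℝ E] (p : M)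
    {f : M → E} (hf : Continuous f) :
    ∫ x, f x ∂spaceMeasure p = ∫ g : IsomGroup M, f (g • p) ∂normalizedHaar (IsomGroup M) :=
  integral_map (continuous_id.smul continuous_const).aemeasurable hf.aestronglyMeasurable

variable {n : ℕ} [ChartedSpace (EuclideanSpace ℝ (Fin n)) M]
  [RiemannianBundle (fun x : M => TangentSpace (𝓡 n) x)] {p : M} (T : MaximalTorus n p)

/-- After Fubini, the inner integral over `G` is constant on the orbit `L p`, so the average over
the torus is that of a constant. -/
theorem integral_integral_torusMeasure {E : Type*} [NormedAddCommGroup E] [NormedSpace ℝ E]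
    [SecondCountableTopology E] [CompleteSpace E] {f : M → E} (hf : Continuous f) :
    ∫ g : IsomGroup M, ∫ x, f (g • x) ∂torusMeasure T ∂normalizedHaar (IsomGroup M) =
      ∫ x, f x ∂spaceMeasure p := by
  have hc : Continuous fun q : IsomGroup M × M => f (q.1 • q.2) := hf.comp continuous_smul
  rw [integral_integral_swap (f := fun (g : IsomGroup M) x => f (g • x))
    (integrable_of_continuous _ hc)]
  have hs : Continuous fun x : M => ∫ g : IsomGroup M, f (g • x) ∂normalizedHaar (IsomGroup M) := by
    have := continuous_parametric_integral_of_continuous (μ := normalizedHaar (IsomGroup M))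
      (f := fun (x : M) (g : IsomGroup M) => f (g • x)) (hc.comp continuous_swap) isCompact_univ
    simpa using this
  rw [torusMeasure, integral_map (measurable_torusOrbit T).aemeasurable hs.aestronglyMeasurable]
  simp_rw [integral_smul_smul_base]
  rw [integral_spaceMeasure p hf]
  simp

theorem norm_toLp_torusTransformC_le (f : C(M, ℂ)) :
    ‖ContinuousMap.toLp (E := ℂ) 2 (torusSpaceMeasure T) ℂ (torusTransformC T f)‖ ≤
      ‖ContinuousMap.toLp (E := ℂ) 2 (spaceMeasure p) ℂ f‖ := by
  refine le_of_sq_le_sq ?_ (norm_nonneg _)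
  have hc : Continuous fun q : IsomGroup M × M => ‖f (q.1 • q.2)‖ ^ 2 :=
    (f.continuous.comp continuous_smul).norm.pow 2
  rw [norm_toLp_sq, norm_toLp_sq,
    integral_torusSpaceMeasure T (f := fun q => ‖torusTransformC T f q‖ ^ 2)
      ((torusTransformC T f).continuous.norm.pow 2),
    ← integral_integral_torusMeasure T (f := fun x => ‖f x‖ ^ 2) (f.continuous.norm.pow 2)]
  refine integral_mono (integrable_of_continuous _ ?_) (integrable_of_continuous _ ?_) fun g => ?_
  · exact ((torusTransformC T f).continuous.comp (TorusSpace.continuous_mk T)).norm.pow 2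
  · have := continuous_parametric_integral_of_continuous (μ := torusMeasure T)
      (f := fun (g : IsomGroup M) (x : M) => ‖f (g • x)‖ ^ 2) hc isCompact_univ
    simpa using this
  · exact norm_integral_sq_le _ (integrable_torusMeasure T f g)
      (integrable_of_continuous _ (hc.comp (Continuous.prodMk_right g)))

end NormInequality

/-! ### Compact operators given by continuous families of vectors -/

section InnerFamily

variable {X H : Type*} [TopologicalSpace X] [CompactSpace X] [NormedAddCommGroup H]
  [InnerProductSpace ℂ H]

/-- The operator that sends `u` to the continuous function `x ↦ ⟪κ x, u⟫`. -/
def innerFamily (κ : C(X, H)) : H →L[ℂ] C(X, ℂ) :=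
  LinearMap.mkContinuous
    { toFun := fun u => ⟨fun x => ⟪κ x, u⟫_ℂ, κ.continuous.inner continuous_const⟩
      map_add' := fun u v => by ext x; exact inner_add_right _ _ _
      map_smul' := fun c u => by ext x; exact inner_smul_right _ _ _ } ‖κ‖ fun u => by
    refine (ContinuousMap.norm_le _ (by positivity)).2 fun x => ?_
    exact (norm_inner_le_norm _ _).trans (by gcongr; exact κ.norm_coe_le_norm x)

/-- By Arzelà–Ascoli, a continuous family of vectors indexed by a compact space defines a
compact operator. -/
theorem isCompactOperator_innerFamily (κ : C(X, H)) : IsCompactOperator (innerFamily κ) := by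
  rw [isCompactOperator_iff_exists_mem_nhds_image_subset_compact]
  refine ⟨Metric.closedBall 0 1, Metric.closedBall_mem_nhds _ one_pos, ?_⟩
  -- Arzelà–Ascoli is applied to bounded continuous functions and carried back along this isometry.
  let e := (ContinuousMap.linearIsometryBoundedOfCompact X ℂ ℂ)
  have hK : IsCompact (closure (e '' (innerFamily κ '' Metric.closedBall 0 1))) := by
    refine BoundedContinuousFunction.arzela_ascoli (Metric.closedBall 0 ‖κ‖)
      (isCompact_closedBall _ _) _ ?_ ?_
    · rintro _ x ⟨_, ⟨u, hu, rfl⟩, rfl⟩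
      rw [mem_closedBall_zero_iff] at hu ⊢
      change ‖⟪κ x, u⟫_ℂ‖ ≤ _
      calc ‖⟪κ x, u⟫_ℂ‖ ≤ ‖κ x‖ * ‖u‖ := norm_inner_le_norm _ _
        _ ≤ ‖κ‖ * 1 := by gcongr; exact κ.norm_coe_le_norm x
        _ = ‖κ‖ := mul_one _
    · intro x₀
      -- By Cauchy–Schwarz, continuity of `κ` at `x₀` gives a modulus common to all `u` in the unit
      -- ball.
      refine Metric.equicontinuousAt_of_continuity_modulus (fun x => ‖κ x₀ - κ x‖) ?_ _ ?_
      · have : Continuous fun x => ‖κ x₀ - κ x‖ := by fun_prop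
        simpa using this.tendsto x₀
      · refine Eventually.of_forall ?_
        rintro x ⟨_, _, ⟨u, hu, rfl⟩, rfl⟩
        rw [mem_closedBall_zero_iff] at hu
        change dist ⟪κ x₀, u⟫_ℂ ⟪κ x, u⟫_ℂ ≤ _
        rw [dist_eq_norm, ← inner_sub_left]
        calc ‖⟪κ x₀ - κ x, u⟫_ℂ‖ ≤ ‖κ x₀ - κ x‖ * ‖u‖ := norm_inner_le_norm _ _
          _ ≤ ‖κ x₀ - κ x‖ * 1 := by gcongr
          _ = _ := mul_one _
  refine ⟨e ⁻¹' closure (e '' (innerFamily κ '' Metric.closedBall 0 1)),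
    e.toHomeomorph.isCompact_preimage.2 hK, fun f hf => subset_closure (mem_image_of_mem e hf)⟩

end InnerFamily

/-! ### The operator with a truncated distance kernel -/

section Kernel

variable {X : Type*} [MetricSpace X]

/-- The kernel `max (ε - dist x y) 0`, as a continuous function of `y`. -/
def bump (ε : ℝ) (x : X) : C(X, ℂ) :=
  ⟨fun y => ((max (ε - dist x y) 0 : ℝ) : ℂ), by fun_prop⟩

theorem bump_apply (ε : ℝ) (x y : X) : bump ε x y = ((max (ε - dist x y) 0 : ℝ) : ℂ) := rfl

theorem bump_comm (ε : ℝ) (x y : X) : bump ε x y = bump ε y x := by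
  rw [bump_apply, bump_apply, dist_comm]

theorem conj_bump (ε : ℝ) (x y : X) : conj (bump ε x y) = bump ε x y := Complex.conj_ofReal _

theorem continuous_bump_uncurry (ε : ℝ) : Continuous fun q : X × X => bump ε q.1 q.2 := by
  simp only [bump_apply]
  fun_prop

theorem continuous_bump (ε : ℝ) : Continuous (bump ε : X → C(X, ℂ)) :=
  ContinuousMap.continuous_of_continuous_uncurry _ (continuous_bump_uncurry ε)

variable [CompactSpace X] [MeasurableSpace X] [BorelSpace X] (μ : Measure X) [IsFiniteMeasure μ]

/-- The integral operator with kernel `max (ε - dist x y) 0`, from `L²` to continuous functions. -/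
def bumpOperator (ε : ℝ) : Lp ℂ 2 μ →L[ℂ] C(X, ℂ) :=
  innerFamily ⟨fun x => ContinuousMap.toLp 2 μ ℂ (bump ε x),
    (ContinuousMap.toLp 2 μ ℂ).continuous.comp (continuous_bump ε)⟩

theorem bumpOperator_apply (ε : ℝ) (u : Lp ℂ 2 μ) (x : X) :
    bumpOperator μ ε u x = ∫ y, bump ε x y * u y ∂μ := by
  change ⟪ContinuousMap.toLp 2 μ ℂ (bump ε x), u⟫_ℂ = _
  rw [L2.inner_def]
  refine integral_congr_ae ?_
  filter_upwards [ContinuousMap.coeFn_toLp (p := 2) (𝕜 := ℂ) μ (bump ε x)] with y hy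
  rw [hy, RCLike.inner_apply, conj_bump, mul_comm]

theorem bumpOperator_toLp (ε : ℝ) (f : C(X, ℂ)) (x : X) :
    bumpOperator μ ε (ContinuousMap.toLp 2 μ ℂ f) x = ∫ y, bump ε x y * f y ∂μ := by
  rw [bumpOperator_apply]
  refine integral_congr_ae ?_
  filter_upwards [ContinuousMap.coeFn_toLp (p := 2) (𝕜 := ℂ) μ f] with y hy
  rw [hy]

/-- The same operator on `L²`. -/
def bumpOperatorL2 (ε : ℝ) : Lp ℂ 2 μ →L[ℂ] Lp ℂ 2 μ :=
  (ContinuousMap.toLp 2 μ ℂ).comp (bumpOperator μ ε)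

/-- The operator factors through the compact map into `C(X, ℂ)`. -/
theorem isCompactOperator_bumpOperatorL2 (ε : ℝ) : IsCompactOperator (bumpOperatorL2 μ ε) :=
  (isCompactOperator_innerFamily (X := X) (H := Lp ℂ 2 μ) _).clm_comp
    (ContinuousMap.toLp (E := ℂ) 2 μ ℂ)

/-- The kernel is real and symmetric, so exchanging the two integrations suffices. -/
theorem isSymmetric_bumpOperatorL2 (ε : ℝ) : (bumpOperatorL2 μ ε).IsSymmetric := by
  intro u v
  have hL (u v : Lp ℂ 2 μ) : ⟪bumpOperatorL2 μ ε u, v⟫_ℂ =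
      ∫ x, ∫ y, bump ε x y * (conj (u y) * v x) ∂μ ∂μ := by
    rw [L2.inner_def]
    refine integral_congr_ae ?_
    filter_upwards [ContinuousMap.coeFn_toLp (p := 2) (𝕜 := ℂ) μ (bumpOperator μ ε u)] with x hx
    change ⟪(ContinuousMap.toLp 2 μ ℂ (bumpOperator μ ε u) : Lp ℂ 2 μ) x, v x⟫_ℂ = _
    rw [hx, bumpOperator_apply, RCLike.inner_apply, ← integral_conj, ← integral_const_mul]
    refine integral_congr_ae (Eventually.of_forall fun y => ?_)
    simp only [map_mul, conj_bump]
    ring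
  have hi (u : Lp ℂ 2 μ) : Integrable u μ := (Lp.memLp u).integrable one_le_two
  -- On a finite measure space `L² ⊆ L¹`, so the product of `u` and `v` is integrable; the kernel is
  -- bounded by `max ε 0`, with `ε` of any sign.
  have hint : Integrable (Function.uncurry fun x y => bump ε x y * (conj (u y) * v x))
      (μ.prod μ) := by
    have hconj : Integrable (fun y => conj (u y)) μ :=
      (Complex.conjCLE : ℂ →L[ℝ] ℂ).integrable_comp (hi u)
    have h2 : Integrable (fun q : X × X => v q.1 * conj (u q.2)) (μ.prod μ) :=
      (hi v).mul_prod hconj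
    refine (h2.bdd_mul (c := max ε 0)
      (continuous_bump_uncurry ε).aestronglyMeasurable (Eventually.of_forall fun q => ?_)).congr
      (Eventually.of_forall fun q => ?_)
    · rw [bump_apply, Complex.norm_real, Real.norm_of_nonneg (le_max_right _ _)]
      exact max_le_max (by linarith [dist_nonneg (x := q.1) (y := q.2)]) le_rfl
    · simp only [Function.uncurry, mul_comm]
  change ⟪bumpOperatorL2 μ ε u, v⟫_ℂ = ⟪u, bumpOperatorL2 μ ε v⟫_ℂ
  rw [← inner_conj_symm u, hL, hL, integral_integral_swap hint, ← integral_conj]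
  refine integral_congr_ae (Eventually.of_forall fun x => ?_)
  simp only
  rw [← integral_conj]
  refine integral_congr_ae (Eventually.of_forall fun y => ?_)
  simp only [map_mul, conj_bump, Complex.conj_conj, bump_comm ε x y]
  ring

end Kernel

/-! ### Density of the representative functions -/

section Density

theorem bump_smul_smul {X G : Type*} [MetricSpace X] [Group G] [MulAction G X]
    [IsIsometricSMul G X] (ε : ℝ) (g : G) (x y : X) :
    bump ε (g • x) (g • y) = bump ε x y := by
  rw [bump_apply, bump_apply, dist_smul]

theorem integral_smul_eq {X G : Type*} [MetricSpace X] [MeasurableSpace X] [BorelSpace X]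
    [Group G] [MulAction G X] [IsIsometricSMul G X] (μ : Measure X) [SMulInvariantMeasure G X μ]
    {E : Type*} [NormedAddCommGroup E] [NormedSpace ℝ E] (f : X → E) (g : G) :
    ∫ x, f (g • x) ∂μ = ∫ x, f x ∂μ :=
  (measurePreserving_smul g μ).integral_comp
    (Homeomorph.smul g).measurableEmbedding f

/-- The mass of the kernel is constant along orbits, so a single scalar normalizes the operator
there. -/
theorem integral_bump_smul {X G : Type*} [MetricSpace X] [MeasurableSpace X] [BorelSpace X]
    [Group G] [MulAction G X] [IsIsometricSMul G X] (μ : Measure X) [SMulInvariantMeasure G X μ]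
    (ε : ℝ) (g : G) (x : X) :
    ∫ y, bump ε (g • x) y ∂μ = ∫ y, bump ε x y ∂μ := by
  rw [← integral_smul_eq μ _ g]
  simp only [bump_smul_smul]

theorem integral_norm_bump {X : Type*} [MetricSpace X] [MeasurableSpace X] (μ : Measure X)
    (ε : ℝ) (x : X) :
    ((∫ y, ‖bump ε x y‖ ∂μ : ℝ) : ℂ) = ∫ y, bump ε x y ∂μ := by
  rw [← integral_complex_ofReal]
  refine integral_congr_ae (Eventually.of_forall fun y => ?_)
  simp [bump_apply]

variable {X G : Type*} [MetricSpace X] [CompactSpace X] [MeasurableSpace X] [BorelSpace X]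
  [Group G] [MulAction G X] [IsIsometricSMul G X] (μ : Measure X) [IsFiniteMeasure μ]
  [SMulInvariantMeasure G X μ]

theorem bumpOperator_translate (ε : ℝ) (g : G) (f : C(X, ℂ)) :
    bumpOperator μ ε (ContinuousMap.toLp 2 μ ℂ (translate g f)) =
      translate g (bumpOperator μ ε (ContinuousMap.toLp 2 μ ℂ f)) := by
  ext x
  change _ = bumpOperator μ ε (ContinuousMap.toLp 2 μ ℂ f) (g⁻¹ • x)
  rw [bumpOperator_toLp, bumpOperator_toLp,
    ← integral_smul_eq μ (fun y => bump ε (g⁻¹ • x) y * f y) g⁻¹]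
  simp only [bump_smul_smul]
  rfl

/-- The eigenvectors for non-zero eigenvalues are given by representative functions. -/
theorem exists_representative_of_eigenvector (ε : ℝ) {c : ℂ} (hc : c ≠ 0) {u : Lp ℂ 2 μ}
    (hu : bumpOperatorL2 μ ε u = c • u) :
    ∃ f ∈ representativeFunctions G X, ContinuousMap.toLp 2 μ ℂ f = u := by
  let J : C(X, ℂ) →L[ℂ] Lp ℂ 2 μ := ContinuousMap.toLp 2 μ ℂ
  -- The eigenspace is taken among continuous functions, where translation is defined pointwise.
  let W : Submodule ℂ C(X, ℂ) :=
    LinearMap.ker (((bumpOperator μ ε).comp J - c • ContinuousLinearMap.id ℂ C(X, ℂ) :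
      C(X, ℂ) →L[ℂ] C(X, ℂ)) : C(X, ℂ) →ₗ[ℂ] C(X, ℂ))
  have hW (f : C(X, ℂ)) : f ∈ W ↔ bumpOperator μ ε (J f) = c • f := by
    simp [W, sub_eq_zero]
  have := ContinuousLinearMap.finite_dimensional_eigenspace
    (isCompactOperator_bumpOperatorL2 μ ε) c hc
  have hmaps : ∀ f ∈ W, (J : C(X, ℂ) →ₗ[ℂ] Lp ℂ 2 μ) f ∈
      Module.End.eigenspace (bumpOperatorL2 μ ε).toLinearMap c := by
    intro f hf
    rw [hW] at hf
    rw [Module.End.mem_eigenspace_iff]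
    change J (bumpOperator μ ε (J f)) = c • J f
    rw [hf, map_smul]
  -- `J` may fail to be injective on `C(X, ℂ)`, but on `W` it is: `J f = 0` forces `c • f = 0`. So
  -- `W` embeds in the finite-dimensional `L²` eigenspace.
  have hfin : FiniteDimensional ℂ W := by
    refine FiniteDimensional.of_injective
      ((J : C(X, ℂ) →ₗ[ℂ] Lp ℂ 2 μ).restrict hmaps) ?_
    rw [injective_iff_map_eq_zero]
    rintro ⟨f, hf⟩ h0
    have h0' : J f = 0 := congrArg Subtype.val h0
    rw [hW, h0', map_zero] at hf
    exact Subtype.ext ((smul_eq_zero.1 hf.symm).resolve_left hc)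
  -- The operator takes values in continuous functions, so dividing by `c` gives a continuous
  -- representative of `u`.
  have hJ : J (c⁻¹ • bumpOperator μ ε u) = u := by
    rw [map_smul]
    change c⁻¹ • bumpOperatorL2 μ ε u = u
    rw [hu, inv_smul_smul₀ hc]
  refine ⟨c⁻¹ • bumpOperator μ ε u, ?_, hJ⟩
  have hmem : c⁻¹ • bumpOperator μ ε u ∈ W := by
    rw [hW, hJ, smul_inv_smul₀ hc]
  have hle : translateSpan G (c⁻¹ • bumpOperator μ ε u) ≤ W := by
    refine Submodule.span_le.2 ?_
    rintro _ ⟨g, rfl⟩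
    rw [SetLike.mem_coe, hW]
    rw [hW] at hmem
    change bumpOperator μ ε (ContinuousMap.toLp 2 μ ℂ (translate g _)) = _
    rw [bumpOperator_translate]
    change translate g (bumpOperator μ ε (J _)) = _
    rw [hmem, map_smul]
  exact Submodule.finiteDimensional_of_le hle

/-- By the spectral theorem it is enough that the image of `w` is orthogonal to every eigenspace. By
symmetry its inner product with an eigenvector `u` is `c * ⟪w, u⟫`: either `c = 0`, or `u` comes
from a representative function. -/
theorem bumpOperatorL2_eq_zero_of_orthogonal (ε : ℝ) {w : Lp ℂ 2 μ}
    (hw : ∀ f ∈ representativeFunctions G X, ⟪w, ContinuousMap.toLp 2 μ ℂ f⟫_ℂ = 0) :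
    bumpOperatorL2 μ ε w = 0 := by
  rw [← Submodule.mem_bot ℂ, ← ContinuousLinearMap.orthogonalComplement_iSup_eigenspaces_eq_bot
    (isCompactOperator_bumpOperatorL2 μ ε) (isSymmetric_bumpOperatorL2 μ ε),
    ← Submodule.iInf_orthogonal, Submodule.mem_iInf]
  intro c
  rw [Submodule.mem_orthogonal']
  intro u hu
  rw [Module.End.mem_eigenspace_iff] at hu
  have hsymm : ⟪bumpOperatorL2 μ ε w, u⟫_ℂ = ⟪w, bumpOperatorL2 μ ε u⟫_ℂ :=
    isSymmetric_bumpOperatorL2 μ ε w u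
  change bumpOperatorL2 μ ε u = c • u at hu
  rw [hsymm, hu, inner_smul_right]
  rcases eq_or_ne c 0 with rfl | hc
  · rw [zero_mul]
  · obtain ⟨f, hf, rfl⟩ := exists_representative_of_eigenvector (G := G) μ ε hc hu
    rw [hw f hf, mul_zero]

theorem integral_norm_bump_pos {ε : ℝ} {p : X} (hp : 0 < μ (Metric.ball p ε)) :
    0 < ∫ y, ‖bump ε p y‖ ∂μ := by
  rw [integral_pos_iff_support_of_nonneg (fun y => norm_nonneg _)
    (integrable_of_continuous μ (bump ε p).continuous.norm)]
  refine hp.trans_le (measure_mono fun y hy => ?_)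
  simpa [bump_apply, dist_comm] using hy

/-- The kernel vanishes at distance at least `ε`, so only the oscillation of `f` on the `ε`-ball
around `x` contributes. -/
theorem norm_bumpOperator_sub_le {ε δ : ℝ} {f : C(X, ℂ)} {x : X}
    (hf : ∀ y, dist x y < ε → ‖f y - f x‖ ≤ δ) :
    ‖bumpOperator μ ε (ContinuousMap.toLp 2 μ ℂ f) x - (∫ y, bump ε x y ∂μ) * f x‖ ≤
      (∫ y, ‖bump ε x y‖ ∂μ) * δ := by
  rw [bumpOperator_toLp, ← integral_mul_const, ← integral_sub, ← integral_mul_const]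
  · refine norm_integral_le_of_norm_le
      (integrable_of_continuous μ ((bump ε x).continuous.norm.mul continuous_const))
      (Eventually.of_forall fun y => ?_)
    rw [← mul_sub, norm_mul]
    by_cases hy : dist x y < ε
    · gcongr
      exact hf y hy
    · have : bump ε x y = 0 := by
        rw [bump_apply, max_eq_right (by linarith), Complex.ofReal_zero]
      simp [this]
  · exact integrable_of_continuous μ ((bump ε x).continuous.mul f.continuous)
  · exact integrable_of_continuous μ ((bump ε x).continuous.mul continuous_const)

theorem norm_toLp_le_of_ae_bound [IsProbabilityMeasure μ] {f : C(X, ℂ)} {C : ℝ} (hC : 0 ≤ C)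
    (h : ∀ᵐ x ∂μ, ‖f x‖ ≤ C) : ‖ContinuousMap.toLp (E := ℂ) 2 μ ℂ f‖ ≤ C := by
  have h' : ∀ᵐ x ∂μ, ‖(ContinuousMap.toLp 2 μ ℂ f : Lp ℂ 2 μ) x‖ ≤ C := by
    filter_upwards [h, ContinuousMap.coeFn_toLp (p := 2) (𝕜 := ℂ) μ f] with x h1 h2
    rwa [h2]
  simpa [measureUnivNNReal] using Lp.norm_le_of_ae_bound hC h'

/-- For an isometric action of a group on a compact metric space with an invariant probability
measure that is concentrated on an orbit, the representative functions are dense in `L²`. -/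
theorem denseRange_representativeFunctions [IsProbabilityMeasure μ] {p : X}
    (hp : ∀ ε > 0, 0 < μ (Metric.ball p ε)) (horb : ∀ᵐ x ∂μ, x ∈ MulAction.orbit G p) :
    DenseRange ((ContinuousMap.toLp (E := ℂ) 2 μ ℂ : C(X, ℂ) →ₗ[ℂ] Lp ℂ 2 μ) ∘ₗ
      (representativeFunctions G X).subtype) := by
  let J : C(X, ℂ) →L[ℂ] Lp ℂ 2 μ := ContinuousMap.toLp 2 μ ℂ
  let S := LinearMap.range ((J : C(X, ℂ) →ₗ[ℂ] Lp ℂ 2 μ) ∘ₗ (representativeFunctions G X).subtype)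
  change Dense (S : Set (Lp ℂ 2 μ))
  rw [Submodule.dense_iff_topologicalClosure_eq_top, Submodule.topologicalClosure_eq_top_iff,
    Submodule.eq_bot_iff]
  intro w hw
  have hw0 : ∀ ε, bumpOperatorL2 μ ε w = 0 := fun ε => by
    refine bumpOperatorL2_eq_zero_of_orthogonal (G := G) μ ε fun f hf => ?_
    exact (Submodule.mem_orthogonal' _ _).1 hw _ ⟨⟨f, hf⟩, rfl⟩
  have hcont : ∀ f : C(X, ℂ), ⟪w, J f⟫_ℂ = 0 := by
    intro f
    have key : ∀ δ > 0, ‖⟪w, J f⟫_ℂ‖ ≤ ‖w‖ * δ := by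
      intro δ hδ
      obtain ⟨ε, hε, hfε⟩ := Metric.uniformContinuous_iff.1
        (CompactSpace.uniformContinuous_of_continuous f.continuous) δ hδ
      -- The mass at `p` serves at almost every point, since almost every point lies on the orbit of
      -- `p`. It may tend to `0` with `ε`, but it appears on both sides of `h5` and cancels.
      set c : ℝ := ∫ y, ‖bump ε p y‖ ∂μ with hc
      have hcpos : 0 < c := integral_norm_bump_pos μ (hp ε hε)
      have h1 : ‖J (bumpOperator μ ε (J f) - (c : ℂ) • f)‖ ≤ c * δ := by
        refine norm_toLp_le_of_ae_bound μ (by positivity) ?_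
        filter_upwards [horb] with x hx
        obtain ⟨g, rfl⟩ := hx
        have hcx : ∫ y, bump ε (g • p) y ∂μ = (c : ℂ) := by
          rw [integral_bump_smul, hc, integral_norm_bump]
        have hcx' : ∫ y, ‖bump ε (g • p) y‖ ∂μ = c := by
          exact_mod_cast (integral_norm_bump μ ε (g • p)).trans hcx
        have := norm_bumpOperator_sub_le μ (ε := ε) (δ := δ) (f := f) (x := g • p) fun y hy => by
          rw [← dist_eq_norm, dist_comm]
          exact (hfε hy).le
        rwa [hcx, hcx'] at this
      have h2 : ⟪w, J (bumpOperator μ ε (J f))⟫_ℂ = 0 := by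
        have h3 : ⟪bumpOperatorL2 μ ε w, J f⟫_ℂ = ⟪w, bumpOperatorL2 μ ε (J f)⟫_ℂ :=
          isSymmetric_bumpOperatorL2 μ ε w (J f)
        rw [hw0, inner_zero_left] at h3
        exact h3.symm
      have h4 : c * ‖⟪w, J f⟫_ℂ‖ = ‖⟪w, J (bumpOperator μ ε (J f) - (c : ℂ) • f)⟫_ℂ‖ := by
        rw [map_sub, map_smul, inner_sub_right, h2, zero_sub, norm_neg, inner_smul_right, norm_mul,
          Complex.norm_real, Real.norm_of_nonneg hcpos.le]
      have h5 : c * ‖⟪w, J f⟫_ℂ‖ ≤ c * (‖w‖ * δ) := by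
        rw [h4]
        calc _ ≤ ‖w‖ * _ := norm_inner_le_norm _ _
          _ ≤ ‖w‖ * (c * δ) := by gcongr
          _ = c * (‖w‖ * δ) := by ring
      exact le_of_mul_le_mul_left h5 hcpos
    rw [← norm_le_zero_iff]
    have hlim : Tendsto (fun δ : ℝ => ‖w‖ * δ) (𝓝[>] 0) (𝓝 0) := by
      have : Continuous fun δ : ℝ => ‖w‖ * δ := by fun_prop
      simpa using (this.tendsto 0).mono_left nhdsWithin_le_nhds
    exact ge_of_tendsto hlim (eventually_mem_nhdsWithin.mono fun δ hδ => key δ hδ)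
  have hdense : DenseRange J := ContinuousMap.toLp_denseRange ℂ μ ℂ (by simp)
  have hall : ∀ v : Lp ℂ 2 μ, ⟪w, v⟫_ℂ = 0 := fun v =>
    hdense.induction_on (p := fun v => ⟪w, v⟫_ℂ = 0) v
      (isClosed_eq (continuous_const.inner continuous_id) continuous_const) hcont
  exact inner_self_eq_zero.1 (hall w)

end Density

/-! ### The normalized invariant measure of the symmetric space -/

section Space

variable {M : Type*} [MetricSpace M] [CompactSpace M]

theorem isIsometricSMul_isomGroup : IsIsometricSMul (IsomGroup M) M :=
  ⟨fun g => (g : M ≃ᵢ M).isometry⟩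

theorem continuous_orbitMap (p : M) : Continuous fun g : IsomGroup M => g • p :=
  continuous_id.smul continuous_const

variable [MeasurableSpace M] [BorelSpace M] (p : M)

instance : SMulInvariantMeasure (IsomGroup M) M (spaceMeasure p) where
  measure_preimage_smul g s hs := by
    have hm := (continuous_orbitMap p).measurable
    rw [spaceMeasure, Measure.map_apply hm hs,
      Measure.map_apply hm (hs.preimage (continuous_const_smul g).measurable),
      ← measure_preimage_mul (normalizedHaar (IsomGroup M)) g
        ((fun h : IsomGroup M => h • p) ⁻¹' s)]
    simp only [preimage_preimage, mul_smul]

/-- The ball pulls back to an open neighbourhood of `1`, which Haar measure charges. -/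
theorem spaceMeasure_ball_pos {ε : ℝ} (hε : 0 < ε) : 0 < spaceMeasure p (Metric.ball p ε) := by
  rw [spaceMeasure, Measure.map_apply (continuous_orbitMap p).measurable measurableSet_ball]
  refine (Metric.isOpen_ball.preimage (continuous_orbitMap p)).measure_pos _ ⟨1, ?_⟩
  simpa using hε

theorem ae_spaceMeasure_mem_orbit :
    ∀ᵐ x ∂spaceMeasure p, x ∈ MulAction.orbit (IsomGroup M) p := by
  have hs : MeasurableSet (MulAction.orbit (IsomGroup M) p) :=
    (isCompact_range (continuous_orbitMap p)).isClosed.measurableSet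
  exact (ae_map_iff (continuous_orbitMap p).aemeasurable hs).2
    (Eventually.of_forall fun g => ⟨g, rfl⟩)

end Space

end FlatRadon

end

theorem mainTheorem6 {n : ℕ} {M : Type*} [MetricSpace M] [CompactSpace M] [ConnectedSpace M]
    [MeasurableSpace M] [BorelSpace M]
    [ChartedSpace (EuclideanSpace ℝ (Fin n)) M] [IsManifold (𝓡 n) ∞ M]
    [RiemannianBundle (fun x : M => TangentSpace (𝓡 n) x)]
    [IsContMDiffRiemannianBundle (𝓡 n) ∞ (EuclideanSpace ℝ (Fin n))
      (fun x : M => TangentSpace (𝓡 n) x)]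
    [IsRiemannianManifold (𝓡 n) M]
    (hM : FlatRadon.IsCompactTypeSymmetricSpace M) (p : M) (T : FlatRadon.MaximalTorus n p) :
    (∀ f : FlatRadon.representativeFunctions (FlatRadon.IsomGroup M) M,
      ‖ContinuousMap.toLp (E := ℂ) 2 (FlatRadon.torusSpaceMeasure T) ℂ
          (FlatRadon.tau0 T f : C(FlatRadon.TorusSpace T, ℂ))‖ ≤
        ‖ContinuousMap.toLp (E := ℂ) 2 (FlatRadon.spaceMeasure p) ℂ (f : C(M, ℂ))‖) ∧
    ∃! τ : Lp ℂ 2 (FlatRadon.spaceMeasure p) →L[ℂ] Lp ℂ 2 (FlatRadon.torusSpaceMeasure T),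
      ∀ f : FlatRadon.representativeFunctions (FlatRadon.IsomGroup M) M,
        τ (ContinuousMap.toLp (E := ℂ) 2 (FlatRadon.spaceMeasure p) ℂ (f : C(M, ℂ))) =
          ContinuousMap.toLp (E := ℂ) 2 (FlatRadon.torusSpaceMeasure T) ℂ
            (FlatRadon.tau0 T f : C(FlatRadon.TorusSpace T, ℂ)) := by
  -- `tau0` is a restriction of `torusTransformC`, so the inequality for continuous functions
  -- applies definitionally.
  have hle (f : FlatRadon.representativeFunctions (FlatRadon.IsomGroup M) M) :=
    FlatRadon.norm_toLp_torusTransformC_le T (f : C(M, ℂ))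
  refine ⟨hle, ?_⟩
  have := FlatRadon.isIsometricSMul_isomGroup (M := M)
  have hdense := FlatRadon.denseRange_representativeFunctions (G := FlatRadon.IsomGroup M)
    (FlatRadon.spaceMeasure p) (fun ε hε => FlatRadon.spaceMeasure_ball_pos p hε)
    (FlatRadon.ae_spaceMeasure_mem_orbit p)
  let F : FlatRadon.representativeFunctions (FlatRadon.IsomGroup M) M →ₗ[ℂ]
      Lp ℂ 2 (FlatRadon.torusSpaceMeasure T) :=
    (ContinuousMap.toLp (E := ℂ) 2 (FlatRadon.torusSpaceMeasure T) ℂ :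
      C(FlatRadon.TorusSpace T, ℂ) →ₗ[ℂ] Lp ℂ 2 (FlatRadon.torusSpaceMeasure T)) ∘ₗ
      (FlatRadon.representativeFunctions (FlatRadon.IsomGroup M)
        (FlatRadon.TorusSpace T)).subtype ∘ₗ FlatRadon.tau0 T
  -- The bound with constant `1` makes `F f` depend only on the `L²` class of `f`, so the map into
  -- `L²(M)` need not be known to be injective.
  refine ⟨F.extendOfNorm _, fun f => LinearMap.extendOfNorm_eq (f := F) hdense
    ⟨1, fun f => (hle f).trans_eq (one_mul _).symm⟩ f, fun τ hτ => ?_⟩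
  exact (LinearMap.extendOfNorm_unique (f := F) hdense 1
    (fun f => (hle f).trans_eq (one_mul _).symm) τ (LinearMap.ext hτ)).symm
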